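/- Let $S^2=\{x\in\mathbb R^3 : |x|=1\}$ be the unit sphere with its surface measure $\sigma$ (total mass $4\pi$). For complex-valued $g\in L^1(S^2,\sigma)$ set $$H(g)=\iint_{S^2\times S^2}\overline{g(\omega)}\,g(\nu)\,|\omega-\nu|\,d\sigma(\omega)\,d\sigma(\nu),$$ where $|\cdot|$ is the Euclidean norm of $\mathbb R^3$, and let $\mu=\frac1{4\pi}\int_{S^2}g\,d\sigma$ be the mean value of $g$. Then the double integral converges absolutely, $H(g)$ is real, and $$H(g)\le H(\mu\mathbf 1)=|\mu|^2H(\mathbf 1),$$ where $\mathbf 1$ denotes the constant function $1$. Moreover, $H(g)=H(\mu\mathbf 1)$ if and only if $g$ is constant $\sigma$-almost everywhere. -/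

import Mathlib

open MeasureTheory

noncomputable section

/-- The unit sphere of `ℝ³` with the Euclidean norm. -/
abbrev S2 : Type := Metric.sphere (0 : EuclideanSpace ℝ (Fin 3)) 1

/-- The surface measure on the unit sphere induced by the Lebesgue measure of `ℝ³`: the measure of
a set is three times the volume of the cone over it, and the total mass is `4 π`. -/
def surfaceMeasure : Measure S2 :=
  (volume : Measure (EuclideanSpace ℝ (Fin 3))).toSphere

/-- The integrand `(ω, ν) ↦ conj (g ω) * g ν * |ω - ν|`. -/
def kernelH (g : S2 → ℂ) (p : S2 × S2) : ℂ :=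
  (starRingEnd ℂ) (g p.1) * g p.2 *
    ((‖(p.1 : EuclideanSpace ℝ (Fin 3)) - (p.2 : EuclideanSpace ℝ (Fin 3))‖ : ℝ) : ℂ)

/-- The quadratic functional `H`, as an integral over the product of the sphere with itself. -/
def functionalH (g : S2 → ℂ) : ℂ :=
  ∫ p, kernelH g p ∂(surfaceMeasure.prod surfaceMeasure)

/-- The mean value of `g` on the sphere. -/
def sphereMean (g : S2 → ℂ) : ℂ :=
  (1 / (4 * (Real.pi : ℂ))) * ∫ ω, g ω ∂surfaceMeasure

end

open MeasureTheory
open scoped Pointwise InnerProductSpace RealInnerProductSpace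

/-! The kernel `-|ω - ν|` is positive definite on functions of mean zero. Indeed `|x|` is a positive
multiple of `∫ (1 - cos ⟪ξ, x⟫) / |ξ|^4 dξ` (`levyIntegral_eq`, `levyConst_pos`). Inserting this
into `H(h)` with `h` of mean zero, the `1` drops out and the cosine factorises, so `H(h)` is minus
the weighted energy of the Fourier transform of `h` (`functionalH_eq_spectral`). Thus `H(h) ≤ 0`,
with equality only if the transform vanishes, that is, if `h = 0` almost everywhere. By rotation
invariance `∫ |ω - ν| dσ(ν)` does not depend on `ω`, so constants are `H`-orthogonal to functions of
mean zero (`functionalH_add_const`), and `H(g) = H(g - μ) + H(μ)`. -/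

/-! ### Integral representation of the Euclidean norm -/

/-- The Fourier weight `(1 - cos ⟪ξ, x⟫) / ‖ξ‖ ^ 4`, whose integral over `ξ` is a multiple
of `‖x‖`. -/
noncomputable def levyDensity (x ξ : EuclideanSpace ℝ (Fin 3)) : ℝ :=
  (1 - Real.cos ⟪ξ, x⟫) / ‖ξ‖ ^ 4

lemma levyDensity_nonneg (x ξ : EuclideanSpace ℝ (Fin 3)) : 0 ≤ levyDensity x ξ :=
  div_nonneg (by linarith [Real.cos_le_one ⟪ξ, x⟫]) (by positivity)

lemma measurable_levyDensity :
    Measurable fun p : EuclideanSpace ℝ (Fin 3) × EuclideanSpace ℝ (Fin 3) =>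
      levyDensity p.1 p.2 := by
  unfold levyDensity
  fun_prop

/-- Quadratic decay at `0` and boundedness at infinity in one bound. The factor `4` comes from `u ^
2 ≥ 1`, where `1 - cos u ≤ 2` and `1 + u ^ 2 ≤ 2 * u ^ 2`. -/
lemma one_sub_cos_le (u : ℝ) : 1 - Real.cos u ≤ 4 * u ^ 2 / (1 + u ^ 2) := by
  rw [le_div_iff₀ (by positivity)]
  have h1 := Real.one_sub_sq_div_two_le_cos (x := u)
  have h2 := Real.neg_one_le_cos u
  rcases le_total (u ^ 2) 1 with h | h <;> nlinarith [sq_nonneg u]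

lemma levyDensity_le (x ξ : EuclideanSpace ℝ (Fin 3)) (hx : ‖x‖ = 1) :
    levyDensity x ξ ≤ 4 * ‖ξ‖ ^ 2 / (1 + ‖ξ‖ ^ 2) / ‖ξ‖ ^ 4 := by
  unfold levyDensity
  gcongr
  refine (one_sub_cos_le _).trans ?_
  have h : ⟪ξ, x⟫ ^ 2 ≤ ‖ξ‖ ^ 2 := by
    have := abs_real_inner_le_norm ξ x
    rw [hx, mul_one] at this
    exact sq_le_sq' (by linarith [neg_abs_le ⟪ξ, x⟫]) ((le_abs_self _).trans this)
  rw [div_le_div_iff₀ (by positivity) (by positivity)]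
  nlinarith

lemma integrable_radial_bound :
    Integrable fun ξ : EuclideanSpace ℝ (Fin 3) => 4 * ‖ξ‖ ^ 2 / (1 + ‖ξ‖ ^ 2) / ‖ξ‖ ^ 4 := by
  rw [integrable_fun_norm_addHaar (volume : Measure (EuclideanSpace ℝ (Fin 3)))
    (f := fun r : ℝ => 4 * r ^ 2 / (1 + r ^ 2) / r ^ 4)]
  -- The polar Jacobian `r ^ 2` reduces the radial bound to `4 / (1 + r ^ 2)`.
  have h : IntegrableOn (fun r : ℝ => 4 * (1 + r ^ 2)⁻¹) (Set.Ioi 0) :=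
    (integrable_inv_one_add_sq.const_mul 4).integrableOn
  refine h.congr_fun (fun r hr => ?_) measurableSet_Ioi
  have hr : (0 : ℝ) < r := hr
  simp only [finrank_euclideanSpace_fin, smul_eq_mul]
  field_simp

/-- The integral of `levyDensity x`. -/
noncomputable def levyIntegral (x : EuclideanSpace ℝ (Fin 3)) : ℝ := ∫ ξ, levyDensity x ξ

lemma integrable_levyDensity_of_norm_eq_one {x : EuclideanSpace ℝ (Fin 3)} (hx : ‖x‖ = 1) :
    Integrable (levyDensity x) := by
  refine integrable_radial_bound.mono'
    (measurable_levyDensity.comp measurable_prodMk_left).aestronglyMeasurable (.of_forall fun ξ => ?_)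
  rw [Real.norm_of_nonneg (levyDensity_nonneg x ξ)]
  exact levyDensity_le x ξ hx

lemma levyDensity_smul {r : ℝ} (hr : r ≠ 0) (x ξ : EuclideanSpace ℝ (Fin 3)) :
    levyDensity (r • x) ξ = r ^ 4 * levyDensity x (r • ξ) := by
  unfold levyDensity
  rw [real_inner_smul_right, real_inner_smul_left, norm_smul, mul_pow, Real.norm_eq_abs,
    Even.pow_abs (by decide)]
  field_simp

lemma integrable_levyDensity (x : EuclideanSpace ℝ (Fin 3)) : Integrable (levyDensity x) := by
  rcases eq_or_ne x 0 with rfl | hx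
  · simp [show levyDensity 0 = fun _ => 0 by ext; simp [levyDensity]]
  have hn : ‖x‖ ≠ 0 := norm_ne_zero_iff.2 hx
  have h1 : ‖(‖x‖⁻¹ • x)‖ = 1 := by rw [norm_smul, norm_inv, norm_norm, inv_mul_cancel₀ hn]
  have h2 : levyDensity x = fun ξ => ‖x‖ ^ 4 * levyDensity (‖x‖⁻¹ • x) (‖x‖ • ξ) := by
    ext ξ
    rw [← levyDensity_smul hn, smul_smul, mul_inv_cancel₀ hn, one_smul]
  rw [h2]
  exact ((integrable_levyDensity_of_norm_eq_one h1).comp_smul hn).const_mul _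

/-- The density contributes `r ^ 4` and the change of variables `r ^ (-3)`; the exponent `4` of the
weight is what makes the degree `1`. -/
lemma levyIntegral_smul {r : ℝ} (hr : 0 < r) (x : EuclideanSpace ℝ (Fin 3)) :
    levyIntegral (r • x) = r * levyIntegral x := by
  unfold levyIntegral
  simp_rw [levyDensity_smul hr.ne', integral_const_mul]
  rw [Measure.integral_comp_smul volume (levyDensity x) r, finrank_euclideanSpace_fin,
    abs_of_pos (by positivity), smul_eq_mul]
  field_simp

lemma levyIntegral_isometry (A : EuclideanSpace ℝ (Fin 3) ≃ₗᵢ[ℝ] EuclideanSpace ℝ (Fin 3))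
    (x : EuclideanSpace ℝ (Fin 3)) : levyIntegral (A x) = levyIntegral x := by
  unfold levyIntegral
  rw [← A.measurePreserving.integral_comp A.toHomeomorph.measurableEmbedding]
  simp [levyDensity]

lemma levyIntegral_eq_of_norm_eq {x y : EuclideanSpace ℝ (Fin 3)} (h : ‖x‖ = ‖y‖) :
    levyIntegral x = levyIntegral y := by
  rw [← Submodule.reflection_sub h, levyIntegral_isometry]

/-- The value of `levyIntegral` at unit vectors. -/
noncomputable def levyConst : ℝ := levyIntegral (EuclideanSpace.single 0 1)

lemma levyIntegral_eq (x : EuclideanSpace ℝ (Fin 3)) : levyIntegral x = levyConst * ‖x‖ := by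
  rcases eq_or_ne x 0 with rfl | hx
  · simp [levyIntegral, levyDensity]
  have hn : 0 < ‖x‖ := norm_pos_iff.2 hx
  rw [levyConst, mul_comm, ← levyIntegral_smul hn]
  apply levyIntegral_eq_of_norm_eq
  simp [norm_smul]

lemma levyConst_pos : 0 < levyConst := by
  have h0 : 0 ≤ levyConst := integral_nonneg (levyDensity_nonneg _)
  refine h0.lt_of_ne' fun h => ?_
  set e : EuclideanSpace ℝ (Fin 3) := EuclideanSpace.single 0 1 with he
  have h1 : levyDensity e =ᵐ[volume] 0 :=
    (integral_eq_zero_iff_of_nonneg (levyDensity_nonneg e) (integrable_levyDensity e)).1 h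
  have h2 : (fun ξ : EuclideanSpace ℝ (Fin 3) => Real.cos ⟪ξ, e⟫) =ᵐ[volume] fun _ => 1 := by
    filter_upwards [h1, compl_mem_ae_iff.2 (measure_singleton (μ := volume) 0)] with ξ hξ hξ0
    have : ‖ξ‖ ≠ 0 := norm_ne_zero_iff.2 hξ0
    simp only [levyDensity, Pi.zero_apply, div_eq_zero_iff] at hξ
    rcases hξ with hξ | hξ
    · linarith
    · exact absurd (pow_eq_zero_iff (by norm_num) |>.1 hξ) this
  -- By continuity the cosine would be `1` everywhere, yet at `π • e` it is `-1`.
  have h3 := congrFun (Continuous.ae_eq_iff_eq volume (by fun_prop) (by fun_prop) |>.1 h2)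
    (Real.pi • e)
  simp only [real_inner_smul_left, real_inner_self_eq_norm_sq] at h3
  norm_num [he] at h3

/-! ### Surface measure and its rotation invariance -/

instance : IsFiniteMeasure surfaceMeasure := by unfold surfaceMeasure; infer_instance

lemma surfaceMeasure_real_univ : surfaceMeasure.real Set.univ = 4 * Real.pi := by
  rw [surfaceMeasure, Measure.toSphere_real_apply_univ, measureReal_def,
    EuclideanSpace.volume_ball_fin_three]
  have h : (0 : ℝ) ≤ Real.pi * 4 / 3 := by positivity
  simp only [finrank_euclideanSpace_fin, ENNReal.ofReal_one, one_pow, one_mul,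
    ENNReal.toReal_ofReal h]
  push_cast
  ring

/-- The action of a linear isometry on the sphere. -/
noncomputable def sphereMap (A : EuclideanSpace ℝ (Fin 3) ≃ₗᵢ[ℝ] EuclideanSpace ℝ (Fin 3)) : S2 ≃ₜ S2 where
  toFun x := ⟨A x, by simp⟩
  invFun x := ⟨A.symm x, by simp⟩
  left_inv x := by simp
  right_inv x := by simp
  continuous_toFun := by fun_prop
  continuous_invFun := by fun_prop

/-- Surface measure is a multiple of cone volume, and an isometry carries cones to cones. -/
lemma measurePreserving_sphereMap
    (A : EuclideanSpace ℝ (Fin 3) ≃ₗᵢ[ℝ] EuclideanSpace ℝ (Fin 3)) :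
    MeasurePreserving (sphereMap A) surfaceMeasure surfaceMeasure := by
  refine ⟨(sphereMap A).continuous.measurable, ?_⟩
  ext s hs
  have hpre := (sphereMap A).continuous.measurable hs
  rw [Measure.map_apply (sphereMap A).continuous.measurable hs, surfaceMeasure,
    Measure.toSphere_apply' _ hs, Measure.toSphere_apply' _ hpre]
  congr 1
  rw [← MeasurePreserving.measure_preimage_equiv (f := A.toMeasurableEquiv) A.measurePreserving
    (Set.Ioo (0 : ℝ) 1 • _ '' s)]
  congr 1
  ext x
  simp only [Set.mem_smul, Set.mem_image, Set.mem_preimage]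
  constructor
  · rintro ⟨r, hr, _, ⟨y, hy, rfl⟩, rfl⟩
    exact ⟨r, hr, _, ⟨sphereMap A y, hy, rfl⟩, (A.map_smul r _).symm⟩
  · rintro ⟨r, hr, _, ⟨y, hy, rfl⟩, h⟩
    refine ⟨r, hr, _, ⟨(sphereMap A).symm y, by simpa using hy, rfl⟩, A.injective ?_⟩
    refine (A.map_smul r _).trans (Eq.trans ?_ h)
    congr 1
    exact A.apply_symm_apply _

lemma integral_norm_sub_const (ω ω' : S2) :
    ∫ ν : S2, ‖(ω : EuclideanSpace ℝ (Fin 3)) - ν‖ ∂surfaceMeasure =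
      ∫ ν : S2, ‖(ω' : EuclideanSpace ℝ (Fin 3)) - ν‖ ∂surfaceMeasure := by
  have h : ‖(ω : EuclideanSpace ℝ (Fin 3))‖ = ‖(ω' : EuclideanSpace ℝ (Fin 3))‖ := by simp
  -- The reflection exchanging `ω` and `ω'`.
  set A := (ℝ ∙ ((ω : EuclideanSpace ℝ (Fin 3)) - ω'))ᗮ.reflection
  have hA : A ω = (ω' : EuclideanSpace ℝ (Fin 3)) := Submodule.reflection_sub h
  rw [← (measurePreserving_sphereMap A).integral_comp (sphereMap A).measurableEmbedding
    fun ν : S2 => ‖(ω' : EuclideanSpace ℝ (Fin 3)) - ν‖]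
  congr 1 with ν
  rw [← hA]
  exact ((congrArg norm (A.map_sub _ _)).symm.trans (A.norm_map _)).symm

/-! ### Fourier uniqueness on the sphere -/

/-- A real function on the sphere all of whose Fourier coefficients vanish is zero. -/
lemma ae_eq_zero_of_fourier_eq_zero {f : S2 → ℝ} (hf : Integrable f surfaceMeasure)
    (hc : ∀ ξ : EuclideanSpace ℝ (Fin 3),
      ∫ ω : S2, f ω * Real.cos ⟪(ω : EuclideanSpace ℝ (Fin 3)), ξ⟫ ∂surfaceMeasure = 0)
    (hs : ∀ ξ : EuclideanSpace ℝ (Fin 3),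
      ∫ ω : S2, f ω * Real.sin ⟪(ω : EuclideanSpace ℝ (Fin 3)), ξ⟫ ∂surfaceMeasure = 0) :
    f =ᵐ[surfaceMeasure] 0 := by
  have hval : MeasurableEmbedding ((↑) : S2 → EuclideanSpace ℝ (Fin 3)) :=
    MeasurableEmbedding.subtype_coe Metric.isClosed_sphere.measurableSet
  -- The positive and negative parts of `f` define finite measures; pushed to `ℝ³`, they have equal
  -- characteristic functions, hence agree.
  set P := surfaceMeasure.withDensity fun ω => ENNReal.ofReal (f ω) with hP
  set N := surfaceMeasure.withDensity fun ω => ENNReal.ofReal (-f ω) with hN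
  have : IsFiniteMeasure P := isFiniteMeasure_withDensity_ofReal hf.2
  have : IsFiniteMeasure N := isFiniteMeasure_withDensity_ofReal hf.neg.2
  have hmf : AEMeasurable (fun ω => ENNReal.ofReal (f ω)) surfaceMeasure :=
    hf.1.aemeasurable.ennreal_ofReal
  have hmn : AEMeasurable (fun ω => ENNReal.ofReal (-f ω)) surfaceMeasure :=
    hf.1.aemeasurable.neg.ennreal_ofReal
  have key : P.map ((↑) : S2 → EuclideanSpace ℝ (Fin 3)) =
      N.map ((↑) : S2 → EuclideanSpace ℝ (Fin 3)) := by
    apply Measure.ext_of_charFun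
    ext ξ
    set E : S2 → ℂ := fun ω =>
      Complex.exp ((⟪(ω : EuclideanSpace ℝ (Fin 3)), ξ⟫ : ℝ) * Complex.I) with hE
    have hEc : Continuous E := by fun_prop
    have hEn : ∀ ω, ‖E ω‖ ≤ 1 := fun ω => (Complex.norm_exp_ofReal_mul_I _).le
    have hint {u : S2 → ℝ} (hu : Integrable u surfaceMeasure) :
        Integrable (fun ω => u ω • E ω) surfaceMeasure :=
      hu.smul_bdd 1 hEc.aestronglyMeasurable (.of_forall hEn)
    rw [charFun_apply, charFun_apply, hval.integral_map, hval.integral_map, hP, hN,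
      integral_withDensity_eq_integral_toReal_smul₀ hmf (.of_forall fun _ => ENNReal.ofReal_lt_top),
      integral_withDensity_eq_integral_toReal_smul₀ hmn (.of_forall fun _ => ENNReal.ofReal_lt_top),
      ← sub_eq_zero]
    simp only [ENNReal.toReal_ofReal']
    have hsplit : ∀ ω, max (f ω) 0 • E ω - max (-f ω) 0 • E ω =
        ((f ω * Real.cos ⟪(ω : EuclideanSpace ℝ (Fin 3)), ξ⟫ : ℝ) : ℂ) +
        ((f ω * Real.sin ⟪(ω : EuclideanSpace ℝ (Fin 3)), ξ⟫ : ℝ) : ℂ) * Complex.I := by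
      intro ω
      rw [← sub_smul, max_zero_sub_max_neg_zero_eq_self, hE]
      simp only [Complex.exp_mul_I, Complex.real_smul]
      push_cast
      ring
    have hcos : Integrable (fun ω : S2 =>
        f ω * Real.cos ⟪(ω : EuclideanSpace ℝ (Fin 3)), ξ⟫) surfaceMeasure :=
      hf.mul_bdd (c := 1) (Continuous.aestronglyMeasurable (by fun_prop)) (.of_forall fun ω => Real.abs_cos_le_one _)
    have hsin : Integrable (fun ω : S2 =>
        f ω * Real.sin ⟪(ω : EuclideanSpace ℝ (Fin 3)), ξ⟫) surfaceMeasure :=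
      hf.mul_bdd (c := 1) (Continuous.aestronglyMeasurable (by fun_prop)) (.of_forall fun ω => Real.abs_sin_le_one _)
    refine (integral_sub (hint hf.pos_part) (hint hf.neg.pos_part)).symm.trans ?_
    simp only [Pi.neg_apply, hsplit]
    rw [integral_add hcos.ofReal (hsin.ofReal.mul_const _), integral_mul_const,
      integral_complex_ofReal, integral_complex_ofReal, hc, hs]
    simp
  have hPN : P = N := by
    have := congrArg (Measure.comap ((↑) : S2 → EuclideanSpace ℝ (Fin 3))) key
    rwa [hval.comap_map, hval.comap_map] at this
  have hae := (withDensity_eq_iff_of_sigmaFinite hmf hmn).1 hPN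
  filter_upwards [hae] with ω hω
  have hω' := congrArg ENNReal.toReal hω
  simp only [ENNReal.toReal_ofReal'] at hω'
  have := max_zero_sub_max_neg_zero_eq_self (f ω)
  simp only [Pi.zero_apply]
  linarith

/-! ### Integrability of the kernel -/

lemma norm_coe_sub_le (ω ν : S2) :
    ‖(ω : EuclideanSpace ℝ (Fin 3)) - ν‖ ≤ 2 := by
  refine (norm_sub_le _ _).trans ?_
  simp
  norm_num

lemma integrable_conj_mul_prod {u v : S2 → ℂ} (hu : Integrable u surfaceMeasure)
    (hv : Integrable v surfaceMeasure) :
    Integrable (fun p : S2 × S2 => (starRingEnd ℂ) (u p.1) * v p.2)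
      (surfaceMeasure.prod surfaceMeasure) :=
  Integrable.mul_prod (Complex.conjCLE.toContinuousLinearMap.integrable_comp hu) hv

lemma integrable_conj_mul_norm {u v : S2 → ℂ} (hu : Integrable u surfaceMeasure)
    (hv : Integrable v surfaceMeasure) :
    Integrable (fun p : S2 × S2 => (starRingEnd ℂ) (u p.1) * v p.2 *
      ((‖(p.1 : EuclideanSpace ℝ (Fin 3)) - (p.2 : EuclideanSpace ℝ (Fin 3))‖ : ℝ) : ℂ))
      (surfaceMeasure.prod surfaceMeasure) := by
  refine (integrable_conj_mul_prod hu hv).mul_bdd (c := 2) ?_ (.of_forall fun p => ?_)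
  · exact Continuous.aestronglyMeasurable (by fun_prop)
  · simpa using norm_coe_sub_le p.1 p.2

lemma integrable_kernelH {g : S2 → ℂ} (hg : Integrable g surfaceMeasure) :
    Integrable (kernelH g) (surfaceMeasure.prod surfaceMeasure) :=
  integrable_conj_mul_norm hg hg

lemma integral_conj_mul_prod (u v : S2 → ℂ) :
    ∫ p : S2 × S2, (starRingEnd ℂ) (u p.1) * v p.2 ∂(surfaceMeasure.prod surfaceMeasure) =
      (starRingEnd ℂ) (∫ ω, u ω ∂surfaceMeasure) * ∫ ω, v ω ∂surfaceMeasure := by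
  rw [← integral_conj]
  exact integral_prod_mul (fun ω => (starRingEnd ℂ) (u ω)) v

/-! ### Cosine and sine transforms -/

/-- The cosine transform of a function on the sphere. -/
noncomputable def cosTransform (h : S2 → ℂ) (ξ : EuclideanSpace ℝ (Fin 3)) : ℂ :=
  ∫ ω : S2, h ω * (Real.cos ⟪(ω : EuclideanSpace ℝ (Fin 3)), ξ⟫ : ℝ) ∂surfaceMeasure

/-- The sine transform of a function on the sphere. -/
noncomputable def sinTransform (h : S2 → ℂ) (ξ : EuclideanSpace ℝ (Fin 3)) : ℂ :=
  ∫ ω : S2, h ω * (Real.sin ⟪(ω : EuclideanSpace ℝ (Fin 3)), ξ⟫ : ℝ) ∂surfaceMeasure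

lemma integrable_mul_cos {h : S2 → ℂ} (hh : Integrable h surfaceMeasure)
    (ξ : EuclideanSpace ℝ (Fin 3)) :
    Integrable (fun ω : S2 => h ω * (Real.cos ⟪(ω : EuclideanSpace ℝ (Fin 3)), ξ⟫ : ℝ))
      surfaceMeasure :=
  hh.mul_bdd (c := 1) (Continuous.aestronglyMeasurable (by fun_prop)) (.of_forall fun ω => by
    rw [Complex.norm_real]; exact Real.abs_cos_le_one _)

lemma integrable_mul_sin {h : S2 → ℂ} (hh : Integrable h surfaceMeasure)
    (ξ : EuclideanSpace ℝ (Fin 3)) :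
    Integrable (fun ω : S2 => h ω * (Real.sin ⟪(ω : EuclideanSpace ℝ (Fin 3)), ξ⟫ : ℝ))
      surfaceMeasure :=
  hh.mul_bdd (c := 1) (Continuous.aestronglyMeasurable (by fun_prop)) (.of_forall fun ω => by
    rw [Complex.norm_real]; exact Real.abs_sin_le_one _)

lemma continuous_cosTransform {h : S2 → ℂ} (hh : Integrable h surfaceMeasure) :
    Continuous (cosTransform h) := by
  refine continuous_of_dominated (fun ξ => (integrable_mul_cos hh ξ).1)
    (fun ξ => .of_forall fun ω => ?_) hh.norm (.of_forall fun ω => by fun_prop)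
  rw [norm_mul, Complex.norm_real]
  exact mul_le_of_le_one_right (norm_nonneg _) (Real.abs_cos_le_one _)

lemma continuous_sinTransform {h : S2 → ℂ} (hh : Integrable h surfaceMeasure) :
    Continuous (sinTransform h) := by
  refine continuous_of_dominated (fun ξ => (integrable_mul_sin hh ξ).1)
    (fun ξ => .of_forall fun ω => ?_) hh.norm (.of_forall fun ω => by fun_prop)
  rw [norm_mul, Complex.norm_real]
  exact mul_le_of_le_one_right (norm_nonneg _) (Real.abs_sin_le_one _)

lemma ae_eq_zero_of_transforms_eq_zero {h : S2 → ℂ} (hh : Integrable h surfaceMeasure)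
    (hc : cosTransform h = 0) (hs : sinTransform h = 0) : h =ᵐ[surfaceMeasure] 0 := by
  have hre : (fun ω => (h ω).re) =ᵐ[surfaceMeasure] 0 := by
    refine ae_eq_zero_of_fourier_eq_zero hh.re (fun ξ => ?_) (fun ξ => ?_)
    · have := Complex.reCLM.integral_comp_comm (integrable_mul_cos hh ξ)
      simpa only [Complex.reCLM_apply, Complex.re_mul_ofReal, Pi.zero_apply, Complex.zero_re] using
        this.trans (congrArg Complex.re (congrFun hc ξ))
    · have := Complex.reCLM.integral_comp_comm (integrable_mul_sin hh ξ)
      simpa only [Complex.reCLM_apply, Complex.re_mul_ofReal, Pi.zero_apply, Complex.zero_re] using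
        this.trans (congrArg Complex.re (congrFun hs ξ))
  have him : (fun ω => (h ω).im) =ᵐ[surfaceMeasure] 0 := by
    refine ae_eq_zero_of_fourier_eq_zero hh.im (fun ξ => ?_) (fun ξ => ?_)
    · have := Complex.imCLM.integral_comp_comm (integrable_mul_cos hh ξ)
      simpa only [Complex.imCLM_apply, Complex.im_mul_ofReal, Pi.zero_apply, Complex.zero_im] using
        this.trans (congrArg Complex.im (congrFun hc ξ))
    · have := Complex.imCLM.integral_comp_comm (integrable_mul_sin hh ξ)
      simpa only [Complex.imCLM_apply, Complex.im_mul_ofReal, Pi.zero_apply, Complex.zero_im] using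
        this.trans (congrArg Complex.im (congrFun hs ξ))
  filter_upwards [hre, him] with ω h1 h2
  exact Complex.ext h1 h2

/-! ### Spectral form of `H` on functions of mean zero -/

/-- The integrand representing `levyConst * functionalH h` as an integral over `S2 × S2 × ℝ³`. -/
noncomputable def levyKernel (h : S2 → ℂ) (q : (S2 × S2) × EuclideanSpace ℝ (Fin 3)) : ℂ :=
  (starRingEnd ℂ) (h q.1.1) * h q.1.2 *
    (levyDensity ((q.1.1 : EuclideanSpace ℝ (Fin 3)) - q.1.2) q.2 : ℝ)

/-- Justifies Fubini: the weight is nonnegative, so integrating the norm over `ξ` gives `levyConst *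
‖kernelH h p‖`. -/
lemma integrable_levyKernel {h : S2 → ℂ} (hh : Integrable h surfaceMeasure) :
    Integrable (levyKernel h) ((surfaceMeasure.prod surfaceMeasure).prod volume) := by
  have hm : AEStronglyMeasurable (levyKernel h)
      ((surfaceMeasure.prod surfaceMeasure).prod volume) := by
    refine (integrable_conj_mul_prod hh hh).1.comp_fst.mul (Measurable.aestronglyMeasurable ?_)
    refine Complex.measurable_ofReal.comp ?_
    unfold levyDensity
    fun_prop
  rw [integrable_prod_iff hm]
  refine ⟨.of_forall fun p =>
    (integrable_levyDensity ((p.1 : EuclideanSpace ℝ (Fin 3)) - p.2)).ofReal.const_mul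
      ((starRingEnd ℂ) (h p.1) * h p.2), ?_⟩
  have : (fun p : S2 × S2 => ∫ ξ, ‖levyKernel h (p, ξ)‖) =
      fun p => levyConst * ‖kernelH h p‖ := by
    ext p
    simp only [levyKernel, kernelH, norm_mul, Complex.norm_real, norm_norm, integral_const_mul,
      Real.norm_of_nonneg (levyDensity_nonneg _ _)]
    rw [← levyIntegral, levyIntegral_eq]
    ring
  rw [this]
  exact (integrable_kernelH hh).norm.const_mul _

lemma integral_levyKernel_right {h : S2 → ℂ} (p : S2 × S2) :
    ∫ ξ, levyKernel h (p, ξ) = levyConst * kernelH h p := by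
  simp only [levyKernel, kernelH, integral_const_mul, integral_complex_ofReal]
  rw [← levyIntegral, levyIntegral_eq]
  push_cast
  ring

/-- Mean zero removes the `1`, and the addition formula for `cos (a - b)` splits the rest into
products. At `ξ = 0` both sides are `0`, since division by zero gives `0`. -/
lemma integral_levyKernel_left {h : S2 → ℂ} (hh : Integrable h surfaceMeasure)
    (h0 : ∫ ω, h ω ∂surfaceMeasure = 0) (ξ : EuclideanSpace ℝ (Fin 3)) :
    ∫ p, levyKernel h (p, ξ) ∂(surfaceMeasure.prod surfaceMeasure) =
      ((-((‖cosTransform h ξ‖ ^ 2 + ‖sinTransform h ξ‖ ^ 2) / ‖ξ‖ ^ 4) : ℝ) : ℂ) := by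
  have hsplit : ∀ p : S2 × S2, levyKernel h (p, ξ) =
      ((starRingEnd ℂ) (h p.1) * h p.2 -
        (starRingEnd ℂ) (h p.1 * (Real.cos ⟪(p.1 : EuclideanSpace ℝ (Fin 3)), ξ⟫ : ℝ)) *
          (h p.2 * (Real.cos ⟪(p.2 : EuclideanSpace ℝ (Fin 3)), ξ⟫ : ℝ)) -
        (starRingEnd ℂ) (h p.1 * (Real.sin ⟪(p.1 : EuclideanSpace ℝ (Fin 3)), ξ⟫ : ℝ)) *
          (h p.2 * (Real.sin ⟪(p.2 : EuclideanSpace ℝ (Fin 3)), ξ⟫ : ℝ))) *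
      ((‖ξ‖ ^ 4 : ℝ) : ℂ)⁻¹ := by
    intro p
    simp only [levyKernel, levyDensity, inner_sub_right, Real.cos_sub, map_mul, Complex.conj_ofReal,
      real_inner_comm ξ, div_eq_mul_inv]
    push_cast
    ring
  have h1 := integrable_conj_mul_prod hh hh
  have h2 := integrable_conj_mul_prod (integrable_mul_cos hh ξ) (integrable_mul_cos hh ξ)
  have h3 := integrable_conj_mul_prod (integrable_mul_sin hh ξ) (integrable_mul_sin hh ξ)
  have h12 := h1.sub h2
  simp only [Pi.sub_def] at h12
  simp_rw [hsplit]
  rw [integral_mul_const, integral_sub h12 h3, integral_sub h1 h2,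
    integral_conj_mul_prod h h,
    integral_conj_mul_prod
      (fun ω : S2 => h ω * (Real.cos ⟪(ω : EuclideanSpace ℝ (Fin 3)), ξ⟫ : ℝ))
      (fun ω : S2 => h ω * (Real.cos ⟪(ω : EuclideanSpace ℝ (Fin 3)), ξ⟫ : ℝ)),
    integral_conj_mul_prod
      (fun ω : S2 => h ω * (Real.sin ⟪(ω : EuclideanSpace ℝ (Fin 3)), ξ⟫ : ℝ))
      (fun ω : S2 => h ω * (Real.sin ⟪(ω : EuclideanSpace ℝ (Fin 3)), ξ⟫ : ℝ)),
    h0, ← cosTransform, ← sinTransform, map_zero, zero_mul,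
    Complex.conj_mul' (cosTransform h ξ), Complex.conj_mul' (sinTransform h ξ)]
  push_cast
  ring

/-- The energy density of `h` in Fourier space. -/
noncomputable def spectralDensity (h : S2 → ℂ) (ξ : EuclideanSpace ℝ (Fin 3)) : ℝ :=
  (‖cosTransform h ξ‖ ^ 2 + ‖sinTransform h ξ‖ ^ 2) / ‖ξ‖ ^ 4

lemma spectralDensity_nonneg (h : S2 → ℂ) : 0 ≤ spectralDensity h := fun ξ => by
  simp only [Pi.zero_apply, spectralDensity]; positivity

lemma integrable_spectralDensity {h : S2 → ℂ} (hh : Integrable h surfaceMeasure)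
    (h0 : ∫ ω, h ω ∂surfaceMeasure = 0) : Integrable (spectralDensity h) := by
  have := (integrable_levyKernel hh).integral_prod_right
  simp_rw [integral_levyKernel_left hh h0] at this
  refine this.re.neg.congr (.of_forall fun ξ => ?_)
  simp only [Pi.neg_apply, RCLike.re_eq_complex_re, Complex.ofReal_re, neg_neg, spectralDensity]

/-- On functions of mean zero, `functionalH` is a negative multiple of the spectral energy. -/
lemma functionalH_eq_spectral {h : S2 → ℂ} (hh : Integrable h surfaceMeasure)
    (h0 : ∫ ω, h ω ∂surfaceMeasure = 0) :
    functionalH h = ((-(levyConst⁻¹ * ∫ ξ, spectralDensity h ξ) : ℝ) : ℂ) := by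
  have hswap := integral_integral_swap (f := fun p ξ => levyKernel h (p, ξ))
    (integrable_levyKernel hh)
  simp_rw [integral_levyKernel_left hh h0, integral_levyKernel_right] at hswap
  rw [integral_const_mul, integral_complex_ofReal, integral_neg, ← functionalH] at hswap
  have hc : (levyConst : ℂ) ≠ 0 := Complex.ofReal_ne_zero.2 levyConst_pos.ne'
  rw [← mul_right_inj' hc, hswap, ← Complex.ofReal_mul]
  congr 1
  simp only [spectralDensity]
  field_simp [levyConst_pos.ne']

lemma functionalH_eq_zero_iff {h : S2 → ℂ} (hh : Integrable h surfaceMeasure)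
    (h0 : ∫ ω, h ω ∂surfaceMeasure = 0) : functionalH h = 0 ↔ h =ᵐ[surfaceMeasure] 0 := by
  rw [functionalH_eq_spectral hh h0, Complex.ofReal_eq_zero, neg_eq_zero,
    mul_eq_zero_iff_left (inv_ne_zero levyConst_pos.ne'),
    integral_eq_zero_iff_of_nonneg (spectralDensity_nonneg h) (integrable_spectralDensity hh h0)]
  constructor
  · intro hae
    have hz : ∀ᵐ ξ : EuclideanSpace ℝ (Fin 3), cosTransform h ξ = 0 ∧ sinTransform h ξ = 0 := by
      filter_upwards [hae, compl_mem_ae_iff.2 (measure_singleton (μ := volume) 0)] with ξ hξ hξ0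
      have hn : ‖ξ‖ ^ 4 ≠ 0 := pow_ne_zero _ (norm_ne_zero_iff.2 hξ0)
      simp only [spectralDensity, Pi.zero_apply, div_eq_zero_iff, hn, or_false] at hξ
      rw [add_eq_zero_iff_of_nonneg (by positivity) (by positivity)] at hξ
      simpa using hξ
    -- Both transforms are continuous, so vanishing almost everywhere means vanishing everywhere.
    exact ae_eq_zero_of_transforms_eq_zero hh
      (Continuous.ae_eq_iff_eq volume (continuous_cosTransform hh) continuous_const |>.1
        (hz.mono fun _ h => h.1))
      (Continuous.ae_eq_iff_eq volume (continuous_sinTransform hh) continuous_const |>.1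
        (hz.mono fun _ h => h.2))
  · intro hae
    refine .of_forall fun ξ => ?_
    have hc : cosTransform h ξ = 0 :=
      integral_eq_zero_of_ae (hae.mono fun ω hω => by simp [hω])
    have hs : sinTransform h ξ = 0 :=
      integral_eq_zero_of_ae (hae.mono fun ω hω => by simp [hω])
    simp [spectralDensity, hc, hs]

lemma functionalH_re_nonpos {h : S2 → ℂ} (hh : Integrable h surfaceMeasure)
    (h0 : ∫ ω, h ω ∂surfaceMeasure = 0) : (functionalH h).re ≤ 0 := by
  rw [functionalH_eq_spectral hh h0, Complex.ofReal_re]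
  have := integral_nonneg (μ := volume) (spectralDensity_nonneg h)
  have := levyConst_pos
  simp only [Left.neg_nonpos_iff]
  positivity

/-! ### Splitting off the mean -/

lemma functionalH_const (m : ℂ) :
    functionalH (fun _ => m) = ((‖m‖ ^ 2 : ℝ) : ℂ) * functionalH (fun _ => 1) := by
  unfold functionalH
  rw [← integral_const_mul]
  congr 1 with p
  simp only [kernelH, Complex.conj_mul']
  simp

lemma functionalH_one_im : (functionalH fun _ => 1).im = 0 := by
  simp only [functionalH, kernelH, map_one, one_mul, integral_complex_ofReal, Complex.ofReal_im]

/-- The two mixed terms between a function of mean zero and a constant vanish. -/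
lemma functionalH_add_const {h : S2 → ℂ} (hh : Integrable h surfaceMeasure)
    (h0 : ∫ ω, h ω ∂surfaceMeasure = 0) (m : ℂ) :
    functionalH (fun ω => h ω + m) = functionalH h + functionalH (fun _ => m) := by
  have hm : Integrable (fun _ : S2 => m) surfaceMeasure := integrable_const m
  have hconst : ∃ A : ℝ, ∀ ω : S2,
      ∫ ν : S2, ‖(ω : EuclideanSpace ℝ (Fin 3)) - ν‖ ∂surfaceMeasure = A := by
    refine ⟨_, fun ω => integral_norm_sub_const ω ⟨EuclideanSpace.single 0 1, by simp⟩⟩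
  obtain ⟨A, hA⟩ := hconst
  have h1 := integrable_conj_mul_norm hh hm
  have h2 := integrable_conj_mul_norm hm hh
  have hz1 : ∫ p : S2 × S2, (starRingEnd ℂ) (h p.1) * m *
      ((‖(p.1 : EuclideanSpace ℝ (Fin 3)) - (p.2 : EuclideanSpace ℝ (Fin 3))‖ : ℝ) : ℂ)
      ∂(surfaceMeasure.prod surfaceMeasure) = 0 := by
    -- Integrating first over the variable absent from `h` leaves `A` times the mean-zero integral.
    rw [integral_prod _ h1]
    simp_rw [integral_const_mul, integral_complex_ofReal, hA, integral_mul_const]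
    rw [integral_conj, h0]
    simp
  have hz2 : ∫ p : S2 × S2, (starRingEnd ℂ) m * h p.2 *
      ((‖(p.1 : EuclideanSpace ℝ (Fin 3)) - (p.2 : EuclideanSpace ℝ (Fin 3))‖ : ℝ) : ℂ)
      ∂(surfaceMeasure.prod surfaceMeasure) = 0 := by
    rw [integral_prod_symm _ h2]
    simp_rw [integral_const_mul, integral_complex_ofReal, norm_sub_rev, hA, integral_mul_const,
      integral_const_mul]
    rw [h0]
    simp
  have hsplit : ∀ p, kernelH (fun ω => h ω + m) p = (kernelH h p + kernelH (fun _ => m) p) +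
      ((starRingEnd ℂ) (h p.1) * m *
        ((‖(p.1 : EuclideanSpace ℝ (Fin 3)) - (p.2 : EuclideanSpace ℝ (Fin 3))‖ : ℝ) : ℂ) +
      (starRingEnd ℂ) m * h p.2 *
        ((‖(p.1 : EuclideanSpace ℝ (Fin 3)) - (p.2 : EuclideanSpace ℝ (Fin 3))‖ : ℝ) : ℂ)) := by
    intro p
    simp only [kernelH, map_add]
    ring
  have hk := integrable_kernelH hh
  have hk' := integrable_kernelH hm
  unfold functionalH
  have hkk := hk.add hk'
  have h12 := h1.add h2
  simp only [Pi.add_def] at hkk h12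
  simp_rw [hsplit]
  rw [integral_add hkk h12, integral_add hk hk', integral_add h1 h2, hz1, hz2]
  simp

lemma integral_sub_sphereMean {g : S2 → ℂ} (hg : Integrable g surfaceMeasure) :
    ∫ ω, (g ω - sphereMean g) ∂surfaceMeasure = 0 := by
  rw [integral_sub hg (integrable_const _), integral_const, surfaceMeasure_real_univ, sphereMean,
    Complex.real_smul]
  have : (Real.pi : ℂ) ≠ 0 := Complex.ofReal_ne_zero.2 Real.pi_ne_zero
  push_cast
  field_simp
  ring

lemma sphereMean_eq_of_ae_eq_const {g : S2 → ℂ} {c : ℂ} (h : g =ᵐ[surfaceMeasure] fun _ => c) :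
    sphereMean g = c := by
  rw [sphereMean, integral_congr_ae h, integral_const, surfaceMeasure_real_univ, Complex.real_smul]
  have : (Real.pi : ℂ) ≠ 0 := Complex.ofReal_ne_zero.2 Real.pi_ne_zero
  push_cast
  field_simp

theorem theorem2 (g : S2 → ℂ) (hg : MemLp g 1 surfaceMeasure) :
    -- the double integral defining `H g` converges absolutely, and `H g` is real
    Integrable (kernelH g) (surfaceMeasure.prod surfaceMeasure) ∧
    (functionalH g).im = 0 ∧
    -- `H g ≤ H (μ 1) = |μ|² H 1`, where `μ` is the mean value of `g`
    (functionalH g).re ≤ (functionalH (fun _ => sphereMean g)).re ∧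
    functionalH (fun _ => sphereMean g) =
      ((‖sphereMean g‖ ^ 2 : ℝ) : ℂ) * functionalH (fun _ => 1) ∧
    -- equality holds exactly for constant `g` (as an element of `L¹`)
    (functionalH g = functionalH (fun _ => sphereMean g) ↔
      ∃ c : ℂ, g =ᵐ[surfaceMeasure] fun _ => c) := by
  have hg' : Integrable g surfaceMeasure := memLp_one_iff_integrable.1 hg
  have hh : Integrable (fun ω => g ω - sphereMean g) surfaceMeasure :=
    hg'.sub (integrable_const _)
  have h0 := integral_sub_sphereMean hg'
  have hdecomp : functionalH g =
      functionalH (fun ω => g ω - sphereMean g) + functionalH (fun _ => sphereMean g) := by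
    rw [← functionalH_add_const hh h0]
    simp
  refine ⟨integrable_kernelH hg', ?_, ?_, functionalH_const _, ?_⟩
  · rw [hdecomp, functionalH_eq_spectral hh h0, functionalH_const]
    simp only [Complex.add_im, Complex.ofReal_im, Complex.im_ofReal_mul, functionalH_one_im,
      mul_zero, add_zero]
  · rw [hdecomp, Complex.add_re]
    linarith [functionalH_re_nonpos hh h0]
  · rw [hdecomp, add_eq_right, functionalH_eq_zero_iff hh h0]
    constructor
    · exact fun h => ⟨sphereMean g, h.mono fun ω hω => sub_eq_zero.1 hω⟩
    -- A constant `c` is necessarily the mean.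
    · rintro ⟨c, hc⟩
      filter_upwards [hc] with ω hω
      simp [hω, sphereMean_eq_of_ae_eq_const hc]
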